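/- Let $\Gamma$ be a connected compact metric graph with at least one edge: finitely many vertices and edges, no loops or multiple edges, each edge $\mathbf e$ having a finite length $\ell_{\mathbf e}>0$ and being identified with $[0,\ell_{\mathbf e}]$, where $0$ corresponds to its initial vertex $\mathrm i_{\mathbf e}$ and $\ell_{\mathbf e}$ to its terminal vertex $\mathrm f_{\mathbf e}$. A function $u$ on $\Gamma$ is a family of functions $[u]_{\mathbf e}$ on $(0,\ell_{\mathbf e})$, with $\int_\Gamma u=\sum_{\mathbf e}\int_0^{\ell_{\mathbf e}}[u]_{\mathbf e}\,dx$ and $\|u\|_1=\int_\Gamma|u|$; $\ell(D)$ is the sum over the edges of the Lebesgue measures of $D\cap\mathbf e$; and $u\in BV(\Gamma)$ (respectively $W^{1,2}(\Gamma)$) means $[u]_{\mathbf e}\in BV(0,\ell_{\mathbf e})$ (respectively $W^{1,2}(0,\ell_{\mathbf e})$) for every edge $\mathbf e$, with no continuity condition at the vertices. Let $X_K(\Gamma)$ be the set of $\mathbf z\in W^{1,2}(\Gamma)$ such that at every vertex $\mathbf v$ the Kirchhoff condition $$\sum_{\mathbf e:\ \mathrm f_{\mathbf e}=\mathbf v}[\mathbf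 z]_{\mathbf e}(\ell_{\mathbf e})-\sum_{\mathbf e:\ \mathrm i_{\mathbf e}=\mathbf v}[\mathbf z]_{\mathbf e}(0)=0$$ holds. For $u\in BV(\Gamma)$ put $$TV_\Gamma(u)=\sup\Big\{\Big|\int_\Gamma u\,\mathbf z'\Big| : \mathbf z\in X_K(\Gamma),\ \|\mathbf z\|_{L^\infty(\Gamma)}\le 1\Big\}.$$ A measurable set $D\subset\Gamma$ has finite perimeter if $\chi_D\in BV(\Gamma)$, and then $\mathrm{Per}_\Gamma(D)=TV_\Gamma(\chi_D)$. Define the $\Gamma$-Cheeger constant $$h(\Gamma)=\inf\Big\{\frac{\mathrm{Per}_\Gamma(D)}{\min\{\ell(D),\ell(\Gamma\setminus D)\}} : D\subset\Gamma \text{ of finite perimeter},\ 0<\ell(D)<\ell(\Gamma)\Big\},$$ and call $D$ (that is, the partition $(D,\Gamma\setminus D)$) a Cheeger cut of $\Gamma$ if $D$ has finite perimeter, $0<\ell(D)\le\frac12\ell(\Gamma)$ and $h(\Gamma)=\mathrm{Per}_\Gamma(D)/\ell(D)$. Let $\Pi(\Gamma)$ be the set of $u\in BV(\Gamma)$ with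 $\|u\|_1=1$ for which $0$ is a median, that is, $\ell(\{u<0\})\le\frac12\ell(\Gamma)$ and $\ell(\{u>0\})\le\frac12\ell(\Gamma)$, and let $$\lambda_1(\Gamma)=\inf\{TV_\Gamma(u) : u\in\Pi(\Gamma)\}.$$ Then $h(\Gamma)=\lambda_1(\Gamma)<\infty$. Moreover, there exist $u\in\Pi(\Gamma)$ with $TV_\Gamma(u)=\lambda_1(\Gamma)$ and $t\ge 0$ such that the superlevel set $E_t(u)=\{x\in\Gamma : u(x)>t\}$ is a Cheeger cut of $\Gamma$. In particular, Cheeger cuts exist. -/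

import Mathlib

open MeasureTheory Set
open scoped ENNReal ContDiff

noncomputable section

/-- A connected compact metric graph with vertices `V` and edges `E` (both taken finite below),
without loops and without multiple edges. Each edge `e` has an initial and a terminal vertex and a
finite positive length, and its points are identified with their coordinates in `[0, len e]`
(`0` at `init e`, `len e` at `term e`). -/
structure CompactMetricGraph (V E : Type*) where
  init : E → V
  term : E → V
  len : E → ℝ
  len_pos : ∀ e, 0 < len e
  no_loops : ∀ e, init e ≠ term e
  no_multiple_edges : Function.Injective fun e => s(init e, term e)
  connected : (SimpleGraph.fromEdgeSet (range fun e => s(init e, term e))).Connected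

/-- Test functions `C_c^∞(0, l)`. -/
def IsTestFunction (l : ℝ) (φ : ℝ → ℝ) : Prop :=
  ContDiff ℝ ∞ φ ∧ HasCompactSupport φ ∧ tsupport φ ⊆ Ioo 0 l

/-- `w` is the weak (distributional) derivative of `z` on `(0, l)`. -/
def HasWeakDeriv (l : ℝ) (z w : ℝ → ℝ) : Prop :=
  ∀ φ : ℝ → ℝ, IsTestFunction l φ →
    ∫ x in Ioo 0 l, z x * deriv φ x = -∫ x in Ioo 0 l, w x * φ x

/-- `z ∈ W^{1,2}(0, l)` with weak derivative `w`, where `z` is the representative that is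
continuous on `[0, l]`; `z 0` and `z l` are then its boundary values. -/
structure IsSobolev (l : ℝ) (z w : ℝ → ℝ) : Prop where
  memLp : MemLp z 2 (volume.restrict (Ioo 0 l))
  memLp_deriv : MemLp w 2 (volume.restrict (Ioo 0 l))
  weakDeriv : HasWeakDeriv l z w
  continuousOn : ContinuousOn z (Icc 0 l)

/-- `u ∈ BV(0, l)`: `u` is integrable on `(0, l)` and its distributional derivative is a signed
measure `μ - ν` of finite total variation. -/
def IsBV (l : ℝ) (u : ℝ → ℝ) : Prop :=
  IntegrableOn u (Ioo 0 l) ∧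
    ∃ μ ν : Measure ℝ, IsFiniteMeasure μ ∧ IsFiniteMeasure ν ∧
      ∀ φ : ℝ → ℝ, IsTestFunction l φ →
        ∫ x in Ioo 0 l, u x * deriv φ x = -(∫ x, φ x ∂μ - ∫ x, φ x ∂ν)

namespace CompactMetricGraph

variable {V E : Type*} [Fintype E] (Γ : CompactMetricGraph V E)

/- A function on the graph is a family `u : E → ℝ → ℝ` of functions on the edges, of which only
the values `u e x` with `x ∈ (0, len e)` matter. A subset of the graph is a family `D : E → Set ℝ`
with `D e ⊆ (0, len e)`; the finitely many vertices, which have length zero, are left out. -/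

open Classical in
/-- The edges incident to the vertex `v`. -/
def incidentEdges (v : V) : Finset E :=
  Finset.univ.filter fun e => Γ.init e = v ∨ Γ.term e = v

open Classical in
/-- The outward boundary value at `v` of a vector field `z` on an edge `e` incident to `v`. -/
def outwardValue (z : E → ℝ → ℝ) (e : E) (v : V) : ℝ :=
  if Γ.term e = v then z e (Γ.len e) else -z e 0

/-- `z ∈ X_K(Γ)` with (edgewise weak) derivative `w`: `z ∈ W^{1,2}(Γ)` and `z` satisfies the
Kirchhoff condition at every vertex. -/
structure IsKirchhoff (z w : E → ℝ → ℝ) : Prop where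
  sobolev : ∀ e, IsSobolev (Γ.len e) (z e) (w e)
  kirchhoff : ∀ v, ∑ e ∈ Γ.incidentEdges v, Γ.outwardValue z e v = 0

/-- `u ∈ BV(Γ)`. -/
def MemBV (u : E → ℝ → ℝ) : Prop := ∀ e, IsBV (Γ.len e) (u e)

/-- The integral over the graph. -/
def integral (u : E → ℝ → ℝ) : ℝ := ∑ e, ∫ x in Ioo 0 (Γ.len e), u e x

/-- The total variation `TV_Γ(u)`, the supremum of `|∫_Γ u z'|` over all `z ∈ X_K(Γ)` with
`‖z‖_∞ ≤ 1`. -/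
def totalVariation (u : E → ℝ → ℝ) : ℝ≥0∞ :=
  ⨆ (z : E → ℝ → ℝ) (w : E → ℝ → ℝ) (_ : Γ.IsKirchhoff z w)
    (_ : ∀ e, eLpNorm (z e) ∞ (volume.restrict (Ioo 0 (Γ.len e))) ≤ 1),
    ENNReal.ofReal |Γ.integral fun e x => u e x * w e x|

/-- The characteristic function of a subset of the graph. -/
def char (D : E → Set ℝ) : E → ℝ → ℝ := fun e => (D e).indicator fun _ => 1

/-- The `Γ`-perimeter. -/
def perimeter (D : E → Set ℝ) : ℝ≥0∞ := Γ.totalVariation (char D)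

/-- `D` is a (Lebesgue) measurable subset of the graph of finite perimeter. -/
structure IsFinitePerimeter (D : E → Set ℝ) : Prop where
  subset : ∀ e, D e ⊆ Ioo 0 (Γ.len e)
  measurable : ∀ e, NullMeasurableSet (D e) volume
  memBV : Γ.MemBV (char D)

/-- The length of a subset of the graph. -/
def length (D : E → Set ℝ) : ℝ≥0∞ := ∑ e, volume (D e)

/-- The length `ℓ(Γ)` of the graph. -/
def totalLength : ℝ≥0∞ := ∑ e, ENNReal.ofReal (Γ.len e)

/-- The complement `Γ ∖ D`. -/
def compl (D : E → Set ℝ) : E → Set ℝ := fun e => Ioo 0 (Γ.len e) \ D e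

/-- The superlevel set `E_t(u) = {u > t}`. -/
def superlevel (u : E → ℝ → ℝ) (t : ℝ) : E → Set ℝ := fun e => {x ∈ Ioo 0 (Γ.len e) | t < u e x}

/-- The sublevel set `{u < t}`. -/
def sublevel (u : E → ℝ → ℝ) (t : ℝ) : E → Set ℝ := fun e => {x ∈ Ioo 0 (Γ.len e) | u e x < t}

/-- `m` is a median of `u` with respect to the length measure. -/
def IsMedian (u : E → ℝ → ℝ) (m : ℝ) : Prop :=
  length (Γ.sublevel u m) ≤ Γ.totalLength / 2 ∧ length (Γ.superlevel u m) ≤ Γ.totalLength / 2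

/-- The `Γ`-Cheeger constant `h(Γ)`. -/
def cheegerConstant : ℝ≥0∞ :=
  ⨅ (D : E → Set ℝ) (_ : Γ.IsFinitePerimeter D) (_ : 0 < length D)
    (_ : length D < Γ.totalLength),
    Γ.perimeter D / min (length D) (length (Γ.compl D))

/-- `(D, Γ ∖ D)` is a Cheeger cut of `Γ`. -/
structure IsCheegerCut (D : E → Set ℝ) : Prop where
  finitePerimeter : Γ.IsFinitePerimeter D
  length_pos : 0 < length D
  length_le : length D ≤ Γ.totalLength / 2
  eq : Γ.cheegerConstant = Γ.perimeter D / length D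

/-- The admissible class `Π(Γ)`. -/
structure Admissible (u : E → ℝ → ℝ) : Prop where
  memBV : Γ.MemBV u
  norm_eq_one : (Γ.integral fun e x => |u e x|) = 1
  median : Γ.IsMedian u 0

/-- `λ₁(Γ)`. -/
def lambdaOne : ℝ≥0∞ := ⨅ (u : E → ℝ → ℝ) (_ : Γ.Admissible u), Γ.totalVariation u

end CompactMetricGraph

end

/-! ### Weak derivatives on an interval -/

/-! The argument is a max-flow/min-cut duality, with no compactness theorem in BV. Let `c` be the
least ratio of boundary points to mass among the elementary cuts: a vertex set with one cut point on
each edge leaving it, or a segment in a single edge. These form finitely many compact families of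
constant boundary count, so `c` is attained (`exists_optimal_elementaryCut`).

Lower bound: if `|s| ≤ 1` and `s` has mean zero, then `c * s` is the derivative of a Kirchhoff field
`z` with `|z| ≤ 1` (`exists_isKirchhoff`). On each edge `z` is a primitive plus a free constant,
confined to an interval by the bound; finding constants that balance every vertex is a circulation
problem, solved by Hoffman's theorem (`exists_netInflow_eq_zero`). The capacity intervals are
nonempty by the segment inequalities, and the cut condition holds by the vertex-set inequalities.
Hence `c * ∫ u s` is at most the total variation of `u`. Taking for `s` the sign of `u`, balanced on
`{u = 0}`, gives `λ₁ ≥ c`; a suitable two-valued `s` gives `h ≥ c`.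

Upper bound: by the fundamental theorem of calculus and the Kirchhoff condition, the perimeter of an
elementary cut is at most its boundary count. The optimal cut, or its complement if that is shorter,
is a set `D` of ratio at most `c`, and its normalized characteristic function is an admissible `u`
with `{u > 0} = D`. So both constants equal `c` and both infima are attained. -/

theorem IsTestFunction.apply_zero {l : ℝ} {φ : ℝ → ℝ} (hφ : IsTestFunction l φ) : φ 0 = 0 := by
  by_contra h
  exact lt_irrefl _ (hφ.2.2 (subset_tsupport φ h)).1

theorem IsTestFunction.apply_right {l : ℝ} {φ : ℝ → ℝ} (hφ : IsTestFunction l φ) : φ l = 0 := by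
  by_contra h
  exact lt_irrefl _ (hφ.2.2 (subset_tsupport φ h)).2

theorem IsTestFunction.integral_deriv {l a b : ℝ} {φ : ℝ → ℝ} (hφ : IsTestFunction l φ) :
    ∫ x in a..b, deriv φ x = φ b - φ a :=
  intervalIntegral.integral_deriv_eq_sub (fun x _ => (hφ.1.differentiable (by simp)) x)
    ((hφ.1.continuous_deriv (by simp)).intervalIntegrable _ _)

theorem integral_Ioo_eq_intervalIntegral {l : ℝ} (hl : 0 ≤ l) (f : ℝ → ℝ) :
    ∫ x in Ioo 0 l, f x = ∫ x in (0 : ℝ)..l, f x := by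
  rw [intervalIntegral.integral_of_le hl, integral_Ioc_eq_integral_Ioo]

theorem MeasureTheory.IntegrableOn.intervalIntegrable_of_mem_Icc {l a b : ℝ} {w : ℝ → ℝ}
    (hw : IntegrableOn w (Ioo 0 l)) (ha : a ∈ Icc 0 l) (hb : b ∈ Icc 0 l) :
    IntervalIntegrable w volume a b := by
  have hl : 0 ≤ l := ha.1.trans ha.2
  have h : IntervalIntegrable w volume 0 l :=
    (intervalIntegrable_iff_integrableOn_Ioo_of_le hl).2 hw
  refine h.mono_set ?_
  rw [uIcc_of_le hl]
  exact uIcc_subset_Icc ha hb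

/-- A primitive of an integrable function has that function as its weak derivative. -/
theorem hasWeakDeriv_primitive {l : ℝ} (hl : 0 ≤ l) {w : ℝ → ℝ} (hw : IntegrableOn w (Ioo 0 l))
    (c : ℝ) : HasWeakDeriv l (fun x => c + ∫ t in (0 : ℝ)..x, w t) w := by
  intro φ hφ
  have hi : IntervalIntegrable w volume 0 l :=
    (intervalIntegrable_iff_integrableOn_Ioo_of_le hl).2 hw
  have hac := hi.absolutelyContinuousOnInterval_intervalIntegral (c := 0) (by simp)
  have hφac : AbsolutelyContinuousOnInterval φ 0 l :=
    (hφ.1.contDiffOn.of_le (by simp)).absolutelyContinuousOnInterval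
  have hparts := hac.integral_mul_deriv_eq_deriv_mul hφac
  rw [hφ.apply_zero, hφ.apply_right] at hparts
  have hderiv : ∫ x in (0 : ℝ)..l, deriv (fun x => ∫ t in (0 : ℝ)..x, w t) x * φ x =
      ∫ x in (0 : ℝ)..l, w x * φ x := by
    apply intervalIntegral.integral_congr_ae
    filter_upwards [hi.ae_hasDerivAt_integral] with x hx hxm
    rw [(hx (uIoc_subset_uIcc hxm) 0 (by simp)).deriv]
  rw [integral_Ioo_eq_intervalIntegral hl, integral_Ioo_eq_intervalIntegral hl, ← hderiv]
  have hφi : IntervalIntegrable (deriv φ) volume 0 l :=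
    (hφ.1.continuous_deriv (by simp)).intervalIntegrable _ _
  simp only [add_mul]
  rw [intervalIntegral.integral_add (hφi.const_mul c) (hφi.continuousOn_mul hac.continuousOn),
    hparts, intervalIntegral.integral_const_mul, hφ.integral_deriv, hφ.apply_zero,
    hφ.apply_right]
  ring

/-- A primitive of a smooth function of mean zero with compact support in `(0, l)` is a test
function. -/
theorem isTestFunction_primitive {l : ℝ} {θ : ℝ → ℝ} (hθ : IsTestFunction l θ)
    (hmean : ∫ x in (0 : ℝ)..l, θ x = 0) :
    IsTestFunction l (fun x => ∫ t in (0 : ℝ)..x, θ t) ∧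
      deriv (fun x => ∫ t in (0 : ℝ)..x, θ t) = θ := by
  have hcont : Continuous θ := hθ.1.continuous
  have hd : ∀ x, HasDerivAt (fun x => ∫ t in (0 : ℝ)..x, θ t) (θ x) x := fun x =>
    intervalIntegral.integral_hasDerivAt_right (hcont.intervalIntegrable _ _)
      (hcont.stronglyMeasurableAtFilter _ _) hcont.continuousAt
  have hderiv : deriv (fun x => ∫ t in (0 : ℝ)..x, θ t) = θ := funext fun x => (hd x).deriv
  have hsmooth : ContDiff ℝ ∞ (fun x => ∫ t in (0 : ℝ)..x, θ t) := by
    rw [contDiff_infty_iff_deriv, hderiv]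
    exact ⟨fun x => (hd x).differentiableAt, hθ.1⟩
  -- The primitive vanishes left of `a` because `θ` does, and right of `b` because the mean is zero.
  -- If `θ = 0`, any `a > 0` and `b < l` will do, even with `b < a`.
  obtain ⟨a, b, ha, hb, hab⟩ : ∃ a b, 0 < a ∧ b < l ∧ tsupport θ ⊆ Icc a b := by
    rcases (tsupport θ).eq_empty_or_nonempty with h | h
    · exact ⟨1, l - 1, one_pos, by linarith, by simp [h]⟩
    · have hK : IsCompact (tsupport θ) := hθ.2.1
      obtain ⟨a, ha⟩ := hK.exists_isLeast h
      obtain ⟨b, hb⟩ := hK.exists_isGreatest h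
      exact ⟨a, b, (hθ.2.2 ha.1).1, (hθ.2.2 hb.1).2, fun x hx => ⟨ha.2 hx, hb.2 hx⟩⟩
  have hzero : ∀ x, x ∉ Icc a b → θ x = 0 := fun x hx =>
    image_eq_zero_of_notMem_tsupport fun h => hx (hab h)
  have hsupp : tsupport (fun x => ∫ t in (0 : ℝ)..x, θ t) ⊆ Icc a b := by
    refine closure_minimal ?_ isClosed_Icc
    intro x hx
    by_contra hxab
    apply hx
    simp only
    rcases lt_or_ge x a with h | h
    · rw [intervalIntegral.integral_congr (g := fun _ => 0), intervalIntegral.integral_zero]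
      intro t ht
      refine hzero t fun ht' => ?_
      have := ht.2
      rcases max_cases 0 x with ⟨h1, h2⟩ | ⟨h1, h2⟩ <;> · rw [h1] at this; linarith [ht'.1]
    · have hbx : b < x := by
        by_contra hbx
        exact hxab ⟨h, not_lt.1 hbx⟩
      rw [← intervalIntegral.integral_add_adjacent_intervals (b := l)
        (hcont.intervalIntegrable _ _) (hcont.intervalIntegrable _ _), hmean, zero_add,
        intervalIntegral.integral_congr (g := fun _ => 0), intervalIntegral.integral_zero]
      intro t ht
      refine hzero t fun ht' => ?_
      have h1 : b < min l x := lt_min hb hbx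
      linarith [ht.1, ht'.2]
  exact ⟨⟨hsmooth, HasCompactSupport.of_support_subset_isCompact isCompact_Icc
    ((subset_tsupport _).trans hsupp), fun x hx => ⟨ha.trans_le (hsupp hx).1,
      (hsupp hx).2.trans_lt hb⟩⟩, hderiv⟩

theorem exists_isTestFunction_integral_eq_one {l : ℝ} (hl : 0 < l) :
    ∃ η, IsTestFunction l η ∧ ∫ x in (0 : ℝ)..l, η x = 1 := by
  let f : ContDiffBump (l / 2) := ⟨l / 8, l / 4, by positivity, by linarith⟩
  have hsub : tsupport (f.normed volume) ⊆ Ioo 0 l := by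
    rw [f.tsupport_normed_eq, Real.closedBall_eq_Icc]
    intro x hx
    have h1 := hx.1
    have h2 := hx.2
    simp only [f] at h1 h2
    constructor <;> linarith
  refine ⟨f.normed volume, ⟨f.contDiff_normed, f.hasCompactSupport_normed, hsub⟩, ?_⟩
  rw [← f.integral_normed (μ := volume), ← integral_Ioo_eq_intervalIntegral hl.le]
  exact setIntegral_eq_integral_of_forall_compl_eq_zero fun x hx =>
    image_eq_zero_of_notMem_tsupport fun h => hx (hsub h)

/-- The du Bois-Reymond lemma, for continuous functions. -/
theorem eqOn_const_of_forall_integral_mul_deriv_eq_zero {l : ℝ} (hl : 0 < l) {g : ℝ → ℝ}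
    (hg : ContinuousOn g (Icc 0 l))
    (h : ∀ φ, IsTestFunction l φ → ∫ x in (0 : ℝ)..l, g x * deriv φ x = 0) :
    ∃ c, ∀ x ∈ Icc 0 l, g x = c := by
  obtain ⟨η, hη, hη1⟩ := exists_isTestFunction_integral_eq_one hl
  have hgi : ∀ ψ : ℝ → ℝ, Continuous ψ → IntervalIntegrable (fun x => g x * ψ x) volume 0 l :=
    fun ψ hψ => (ContinuousOn.mul (by rwa [uIcc_of_le hl.le])
      hψ.continuousOn).intervalIntegrable
  set c := ∫ x in (0 : ℝ)..l, g x * η x with hc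
  have hae : ∀ᵐ x ∂volume, x ∈ Ioo 0 l → g x - c = 0 := by
    refine isOpen_Ioo.ae_eq_zero_of_integral_contDiff_smul_eq_zero ?_ ?_
    · exact ((hg.sub continuousOn_const).mono Ioo_subset_Icc_self).locallyIntegrableOn
        measurableSet_Ioo
    intro ψ hψ hψc hψs
    set I := ∫ x in (0 : ℝ)..l, ψ x with hI
    have hψi : IntervalIntegrable ψ volume 0 l := hψ.continuous.intervalIntegrable _ _
    have hηi : IntervalIntegrable η volume 0 l := hη.1.continuous.intervalIntegrable _ _
    -- Subtracting `I * η` removes the mean of `ψ`, so the difference is the derivative of a test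
    -- function; the correction accounts for the constant `c = ∫ g η`.
    have hθ : IsTestFunction l (fun x => ψ x - I * η x) := by
      refine ⟨hψ.sub (contDiff_const.mul hη.1), hψc.sub hη.2.1.mul_left, ?_⟩
      refine (tsupport_sub _ _).trans (union_subset hψs ?_)
      exact (tsupport_mul_subset_right).trans hη.2.2
    have hmean : ∫ x in (0 : ℝ)..l, (ψ x - I * η x) = 0 := by
      rw [intervalIntegral.integral_sub hψi (hηi.const_mul _),
        intervalIntegral.integral_const_mul, hη1]
      simp [hI]
    obtain ⟨hφ, hd⟩ := isTestFunction_primitive hθ hmean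
    have key := h _ hφ
    rw [hd] at key
    have : ∫ x in (0 : ℝ)..l, g x * (ψ x - I * η x) =
        (∫ x in (0 : ℝ)..l, g x * ψ x) - I * c := by
      rw [hc, ← intervalIntegral.integral_const_mul, ← intervalIntegral.integral_sub
        (hgi _ hψ.continuous) ((hgi _ hη.1.continuous).const_mul _)]
      congr 1
      ext x
      ring
    rw [this] at key
    have hres : ∫ x, ψ x • (g x - c) = ∫ x in (0 : ℝ)..l, ψ x • (g x - c) := by
      rw [← integral_Ioo_eq_intervalIntegral hl.le]
      refine (setIntegral_eq_integral_of_forall_compl_eq_zero fun x hx => ?_).symm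
      rw [image_eq_zero_of_notMem_tsupport fun h => hx (hψs h), zero_smul]
    rw [hres]
    have : ∫ x in (0 : ℝ)..l, ψ x • (g x - c) =
        (∫ x in (0 : ℝ)..l, g x * ψ x) - I * c := by
      rw [hI, ← intervalIntegral.integral_mul_const, ← intervalIntegral.integral_sub
        (hgi _ hψ.continuous) (hψi.mul_const _)]
      congr 1
      ext x
      simp only [smul_eq_mul]
      ring
    rw [this, key]
  refine ⟨c, ?_⟩
  have heq : EqOn g (fun _ => c) (Ioo 0 l) := by
    refine Measure.eqOn_open_of_ae_eq (μ := volume) ?_ isOpen_Ioo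
      (hg.mono Ioo_subset_Icc_self) continuousOn_const
    rw [Filter.EventuallyEq, ae_restrict_iff' measurableSet_Ioo]
    filter_upwards [hae] with x hx hxm
    linarith [hx hxm]
  exact heq.of_subset_closure hg continuousOn_const Ioo_subset_Icc_self
    (by rw [closure_Ioo hl.ne])

theorem IsSobolev.integrableOn_deriv {l : ℝ} {z w : ℝ → ℝ} (h : IsSobolev l z w) :
    IntegrableOn w (Ioo 0 l) :=
  h.memLp_deriv.integrable (by norm_num)

/-- The fundamental theorem of calculus for Sobolev functions. -/
theorem IsSobolev.integral_deriv {l a b : ℝ} (hl : 0 < l) {z w : ℝ → ℝ} (h : IsSobolev l z w)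
    (ha : a ∈ Icc 0 l) (hb : b ∈ Icc 0 l) : ∫ x in a..b, w x = z b - z a := by
  have hw := h.integrableOn_deriv
  have hi : IntervalIntegrable w volume 0 l :=
    (intervalIntegrable_iff_integrableOn_Ioo_of_le hl.le).2 hw
  have hF : ContinuousOn (fun x => 0 + ∫ t in (0 : ℝ)..x, w t) (Icc 0 l) := by
    have := (hi.absolutelyContinuousOnInterval_intervalIntegral (c := 0) (by simp)).continuousOn
    rw [uIcc_of_le hl.le] at this
    exact continuousOn_const.add this
  -- `z` and the primitive of `w` have the same weak derivative, so their difference is constant on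
  -- the closed interval, end points included.
  obtain ⟨c, hc⟩ := eqOn_const_of_forall_integral_mul_deriv_eq_zero hl
    (h.continuousOn.sub hF) (fun φ hφ => by
      have h1 := h.weakDeriv φ hφ
      have h2 := hasWeakDeriv_primitive hl.le hw 0 φ hφ
      rw [integral_Ioo_eq_intervalIntegral hl.le] at h1 h2
      have hφc : ContinuousOn (deriv φ) (uIcc 0 l) :=
        (hφ.1.continuous_deriv (by simp)).continuousOn
      simp only [Pi.sub_apply, sub_mul]
      rw [intervalIntegral.integral_sub, h1, h2, sub_self]
      · exact (ContinuousOn.mul (by rw [uIcc_of_le hl.le]; exact h.continuousOn)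
          hφc).intervalIntegrable
      · exact (ContinuousOn.mul (by rw [uIcc_of_le hl.le]; exact hF) hφc).intervalIntegrable)
  have h0 : (0 : ℝ) ∈ Icc 0 l := ⟨le_rfl, hl.le⟩
  have hsplit := intervalIntegral.integral_interval_sub_left
    (hw.intervalIntegrable_of_mem_Icc h0 hb) (hw.intervalIntegrable_of_mem_Icc h0 ha)
  have hca := hc a ha
  have hcb := hc b hb
  simp only [Pi.sub_apply, zero_add] at hca hcb
  rw [← hsplit]
  linarith

/-- Continuity upgrades the essential bound to every point, including the end points where the
Kirchhoff condition lives. The bound is coded as the equation `min |z| 1 = |z|` so that uniqueness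
of continuous extensions applies. -/
theorem abs_le_one_of_eLpNorm_le_one {l : ℝ} (hl : 0 < l) {z : ℝ → ℝ}
    (hz : ContinuousOn z (Icc 0 l)) (h : eLpNorm z ∞ (volume.restrict (Ioo 0 l)) ≤ 1) :
    ∀ x ∈ Icc 0 l, |z x| ≤ 1 := by
  have hae : ∀ᵐ x ∂volume.restrict (Ioo 0 l), min |z x| 1 = |z x| := by
    rw [eLpNorm_exponent_top] at h
    filter_upwards [enorm_ae_le_eLpNormEssSup z (volume.restrict (Ioo 0 l))] with x hx
    have := hx.trans h
    rw [Real.enorm_eq_ofReal_abs, ENNReal.ofReal_le_one] at this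
    exact min_eq_left this
  have heq : EqOn (fun x => min |z x| 1) (fun x => |z x|) (Ioo 0 l) :=
    Measure.eqOn_open_of_ae_eq (μ := volume) hae isOpen_Ioo
      ((ContinuousOn.inf hz.abs continuousOn_const).mono Ioo_subset_Icc_self)
      (hz.abs.mono Ioo_subset_Icc_self)
  have heq' := heq.of_subset_closure (ContinuousOn.inf hz.abs continuousOn_const) hz.abs
    Ioo_subset_Icc_self (by rw [closure_Ioo hl.ne])
  exact fun x hx => min_eq_left_iff.1 (heq' hx)

/-- Primitives of bounded functions are Sobolev functions. -/
theorem isSobolev_primitive {l C : ℝ} (hl : 0 ≤ l) {w : ℝ → ℝ}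
    (hw : AEStronglyMeasurable w (volume.restrict (Ioo 0 l))) (hC : ∀ x, |w x| ≤ C) (c : ℝ) :
    IsSobolev l (fun x => c + ∫ t in (0 : ℝ)..x, w t) w := by
  have hwp : ∀ p, MemLp w p (volume.restrict (Ioo 0 l)) := fun p =>
    MemLp.of_bound hw C (Filter.Eventually.of_forall hC)
  have hi : IntegrableOn w (Ioo 0 l) := (hwp 1).integrable le_rfl
  have hcont : ContinuousOn (fun x => c + ∫ t in (0 : ℝ)..x, w t) (Icc 0 l) := by
    have := (((intervalIntegrable_iff_integrableOn_Ioo_of_le hl).2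
      hi).absolutelyContinuousOnInterval_intervalIntegral (c := 0) (by simp)).continuousOn
    rw [uIcc_of_le hl] at this
    exact continuousOn_const.add this
  refine ⟨?_, hwp 2, hasWeakDeriv_primitive hl hi c, hcont⟩
  obtain ⟨K, hK⟩ := isCompact_Icc.exists_bound_of_continuousOn hcont
  refine MemLp.of_bound ((hcont.mono Ioo_subset_Icc_self).aestronglyMeasurable
    measurableSet_Ioo) K ?_
  filter_upwards [ae_restrict_mem measurableSet_Ioo] with x hx
  exact hK x (Ioo_subset_Icc_self hx)

/-! ### Functions of bounded variation -/

theorem IsBV.const_mul {l c : ℝ} (hc : 0 ≤ c) {u : ℝ → ℝ} (hu : IsBV l u) :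
    IsBV l (fun x => c * u x) := by
  obtain ⟨hi, μ, ν, hμ, hν, h⟩ := hu
  refine ⟨hi.const_mul c, ENNReal.ofReal c • μ, ENNReal.ofReal c • ν,
    Measure.smul_finite μ (by simp), Measure.smul_finite ν (by simp), fun φ hφ => ?_⟩
  simp only [mul_assoc]
  rw [integral_const_mul, h φ hφ, integral_smul_measure, integral_smul_measure,
    ENNReal.toReal_ofReal hc]
  simp only [smul_eq_mul]
  ring

/-- The distributional derivative is `δ_a - δ_b`. A Dirac mass at `0` or `l` is harmless, since test
functions vanish there. -/
theorem isBV_indicator_Ioo {l a b : ℝ} (ha : 0 ≤ a) (hab : a ≤ b) (hb : b ≤ l) :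
    IsBV l ((Ioo a b).indicator fun _ => 1) := by
  refine ⟨(integrableOn_const (by simp)).indicator measurableSet_Ioo, Measure.dirac a,
    Measure.dirac b, inferInstance, inferInstance, fun φ hφ => ?_⟩
  have hmul : (fun x => (Ioo a b).indicator (fun _ => (1 : ℝ)) x * deriv φ x) =
      (Ioo a b).indicator (deriv φ) := by
    ext x
    by_cases hx : x ∈ Ioo a b <;> simp [hx]
  rw [hmul, setIntegral_indicator measurableSet_Ioo,
    inter_eq_self_of_subset_right (Ioo_subset_Ioo ha hb), ← integral_Ioc_eq_integral_Ioo,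
    ← intervalIntegral.integral_of_le hab, hφ.integral_deriv, integral_dirac, integral_dirac]
  ring

/-- Passing to the complement changes the sign of the derivative, so the two measures trade places.
-/
theorem IsBV.indicator_diff {l : ℝ} (hl : 0 ≤ l) {D : Set ℝ} (hD : D ⊆ Ioo 0 l)
    (h : IsBV l (D.indicator fun _ => 1)) : IsBV l ((Ioo 0 l \ D).indicator fun _ => 1) := by
  obtain ⟨hi, μ, ν, hμ, hν, h⟩ := h
  have heq : (Ioo 0 l \ D).indicator (fun _ => (1 : ℝ)) =
      fun x => (Ioo 0 l).indicator (fun _ => 1) x - D.indicator (fun _ => 1) x := by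
    ext x
    by_cases hx : x ∈ D
    · simp [hx, hD hx]
    · by_cases hx' : x ∈ Ioo 0 l <;> simp [hx, hx']
  rw [heq]
  have h1 : IntegrableOn ((Ioo 0 l).indicator fun _ => (1 : ℝ)) (Ioo 0 l) :=
    (integrableOn_const (by simp)).indicator measurableSet_Ioo
  refine ⟨h1.sub hi, ν, μ, hν, hμ, fun φ hφ => ?_⟩
  have hφi : IntegrableOn (deriv φ) (Ioo 0 l) :=
    ((hφ.1.continuous_deriv (by simp)).integrableOn_Icc).mono_set Ioo_subset_Icc_self
  have hDi : IntegrableOn (fun x => D.indicator (fun _ => (1 : ℝ)) x * deriv φ x)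
      (Ioo 0 l) := by
    refine Integrable.bdd_mul (c := 1) hφi hi.aestronglyMeasurable
      (Filter.Eventually.of_forall fun x => ?_)
    by_cases hx : x ∈ D <;> simp [hx]
  have hcongr : ∫ x in Ioo 0 l,
      ((Ioo 0 l).indicator (fun _ => (1 : ℝ)) x - D.indicator (fun _ => 1) x) * deriv φ x =
      ∫ x in Ioo 0 l, (deriv φ x - D.indicator (fun _ => 1) x * deriv φ x) := by
    refine setIntegral_congr_fun measurableSet_Ioo fun x hx => ?_
    simp only [indicator_of_mem hx]
    ring
  rw [hcongr, integral_sub hφi hDi, h φ hφ, integral_Ioo_eq_intervalIntegral hl,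
    hφ.integral_deriv, hφ.apply_zero, hφ.apply_right]
  ring

/-! ### Circulations with bounded capacities -/

section Flow

variable {V E : Type*} [Fintype E] [DecidableEq V]

/-- The net inflow at `v` when the edge `e` carries `f e` out of `init e` and `f e + g e` into
`term e`. -/
def netInflow (init term : E → V) (g f : E → ℝ) (v : V) : ℝ :=
  ∑ e, ((if term e = v then f e + g e else 0) - if init e = v then f e else 0)

theorem netInflow_update [DecidableEq E] (init term : E → V) (g f : E → ℝ) (e : E) (t : ℝ)
    (v : V) :
    netInflow init term g (Function.update f e (f e + t)) v = netInflow init term g f v +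
      t * ((if term e = v then 1 else 0) - if init e = v then 1 else 0) := by
  unfold netInflow
  rw [← sub_eq_iff_eq_add', ← Finset.sum_sub_distrib, Finset.sum_eq_single e]
  · simp only [Function.update_self]
    split_ifs <;> ring
  · intro e' _ he'
    simp [Function.update_of_ne he']
  · simp

theorem sum_netInflow (init term : E → V) (g f : E → ℝ) (S : Finset V) :
    ∑ v ∈ S, netInflow init term g f v =
      ∑ e, ((if term e ∈ S then f e + g e else 0) - if init e ∈ S then f e else 0) := by
  unfold netInflow
  rw [Finset.sum_comm]
  refine Finset.sum_congr rfl fun e _ => ?_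
  rw [Finset.sum_sub_distrib, Finset.sum_ite_eq, Finset.sum_ite_eq]

/-- First-order condition at a one-sided minimum. If `d < 0`, the chosen `t` satisfies `C * t ≤ -d`,
so `2 * d + C * t < 0`; the `+ 1` covers `C = 0`. -/
theorem nonneg_of_forall_quadratic_nonneg {d C τ : ℝ} (hτ : 0 < τ) (hC : 0 ≤ C)
    (h : ∀ t, 0 ≤ t → t ≤ τ → 0 ≤ 2 * t * d + C * t ^ 2) : 0 ≤ d := by
  by_contra! hd
  have ht : 0 < min τ (-d / (C + 1)) := lt_min hτ (div_pos (by linarith) (by linarith))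
  have h1 := h _ ht.le (min_le_left _ _)
  have h2 : min τ (-d / (C + 1)) * (C + 1) ≤ -d :=
    (le_div_iff₀ (by linarith)).1 (min_le_right _ _)
  set t := min τ (-d / (C + 1))
  have h3 : 0 ≤ t * (2 * d + C * t) := by
    rw [show t * (2 * d + C * t) = 2 * t * d + C * t ^ 2 by ring]
    exact h1
  have h4 : 0 ≤ 2 * d + C * t := nonneg_of_mul_nonneg_right h3 ht
  nlinarith

/-- Hoffman's circulation theorem: a flow within the capacities `[a e, b e]` exists as soon as no
vertex set forces too much inflow. -/
theorem exists_netInflow_eq_zero [Fintype V] (init term : E → V) (a b g : E → ℝ) (hab : ∀ e, a e ≤ b e)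
    (hg : ∑ e, g e = 0)
    (hcut : ∀ S : Finset V, ∑ e, ((if term e ∈ S then g e else 0) +
      (if term e ∈ S ∧ init e ∉ S then a e else 0) -
      if init e ∈ S ∧ term e ∉ S then b e else 0) ≤ 0) :
    ∃ f : E → ℝ, (∀ e, f e ∈ Icc (a e) (b e)) ∧ ∀ v, netInflow init term g f v = 0 := by
  classical
  -- Minimize the sum of the squared imbalances over the box of capacities; the cut condition will
  -- force the minimum to be zero.
  have hcont : Continuous fun f => ∑ v, netInflow init term g f v ^ 2 := by
    refine continuous_finsetSum _ fun v _ => Continuous.pow (continuous_finsetSum _ fun e _ => ?_) 2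
    refine Continuous.sub ?_ ?_ <;> split_ifs <;> fun_prop
  obtain ⟨f, hf, hmin⟩ := (isCompact_Icc (a := a) (b := b)).exists_isMinOn
    (nonempty_Icc.2 hab) hcont.continuousOn
  set p := netInflow init term g f with hp
  have hquad : ∀ e, ∃ C : ℝ, 0 ≤ C ∧ ∀ t, f e + t ∈ Icc (a e) (b e) →
      0 ≤ 2 * t * (p (term e) - p (init e)) + C * t ^ 2 := by
    intro e
    refine ⟨∑ v, ((if term e = v then 1 else 0) - if init e = v then (1 : ℝ) else 0) ^ 2,
      Finset.sum_nonneg fun v _ => sq_nonneg _, fun t ht => ?_⟩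
    have hmem : Function.update f e (f e + t) ∈ Icc a b := by
      constructor
      · intro e'
        rcases eq_or_ne e' e with rfl | h
        · simpa using ht.1
        · simpa [h] using hf.1 e'
      · intro e'
        rcases eq_or_ne e' e with rfl | h
        · simpa using ht.2
        · simpa [h] using hf.2 e'
    have hle : ∑ v, p v ^ 2 ≤ ∑ v, netInflow init term g (Function.update f e (f e + t)) v ^ 2 :=
      hmin hmem
    simp only [netInflow_update, ← hp] at hle
    have hexp : ∑ v, (p v + t * ((if term e = v then 1 else 0) -
        if init e = v then 1 else 0)) ^ 2 = ∑ v, p v ^ 2 + (2 * t * (p (term e) - p (init e)) +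
      (∑ v, ((if term e = v then 1 else 0) - if init e = v then (1 : ℝ) else 0) ^ 2) * t ^ 2) := by
      have h1 : p (term e) - p (init e) =
          ∑ v, p v * ((if term e = v then 1 else 0) - if init e = v then 1 else 0) := by
        simp [mul_sub, Finset.sum_sub_distrib]
      rw [h1, Finset.mul_sum, Finset.sum_mul, ← Finset.sum_add_distrib, ← Finset.sum_add_distrib]
      exact Finset.sum_congr rfl fun v _ => by ring
    linarith
  -- Raising `f e` moves imbalance from `init e` to `term e`, which cannot help at a minimizer;
  -- lowering `f e` gives `hdown`.
  have hup : ∀ e, f e < b e → p (init e) ≤ p (term e) := by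
    intro e he
    obtain ⟨C, hC, hq⟩ := hquad e
    exact sub_nonneg.1 (nonneg_of_forall_quadratic_nonneg (sub_pos.2 he) hC fun t h0 ht =>
      hq t ⟨(hf.1 e).trans (by linarith), by linarith⟩)
  have hdown : ∀ e, a e < f e → p (term e) ≤ p (init e) := by
    intro e he
    obtain ⟨C, hC, hq⟩ := hquad e
    refine sub_nonneg.1 (nonneg_of_forall_quadratic_nonneg (sub_pos.2 he) hC fun t h0 ht =>
      (hq (-t) ⟨by linarith, (hf.2 e).trans' (by linarith)⟩).trans_eq ?_)
    ring
  -- Edges leaving `S` are saturated at `b` and edges entering it sit at `a`, so the total imbalance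
  -- in `S` is the quantity bounded by `hcut`. Hence `S` is empty, and imbalances that are
  -- nonpositive with sum zero all vanish.
  set S := Finset.univ.filter fun v => 0 < p v with hS
  have hmemS : ∀ v, v ∈ S ↔ 0 < p v := fun v => by simp [hS]
  have hsumS : ∑ v ∈ S, p v ≤ 0 := by
    rw [hp, sum_netInflow]
    refine (Finset.sum_le_sum fun e _ => ?_).trans (hcut S)
    by_cases ht : term e ∈ S <;> by_cases hi : init e ∈ S <;> simp only [ht, hi, if_true, if_false,
      not_true, not_false_iff, and_true, and_false, and_self]
    · linarith
    · have : f e ≤ a e := by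
        by_contra! h
        rw [hmemS] at ht hi
        linarith [hdown e h]
      linarith
    · have : b e ≤ f e := by
        by_contra! h
        rw [hmemS] at ht hi
        linarith [hup e h]
      linarith
    · linarith
  have hle : ∀ v, p v ≤ 0 := by
    intro v
    by_contra! hv
    have := Finset.single_le_sum (f := p) (fun v hv => ((hmemS v).1 hv).le) ((hmemS v).2 hv)
    linarith
  have hsum : ∑ v, p v = 0 := by
    rw [hp, sum_netInflow, ← hg]
    exact Finset.sum_congr rfl fun e _ => by simp
  exact ⟨f, fun e => ⟨hf.1 e, hf.2 e⟩, fun v =>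
    (Finset.sum_eq_zero_iff_of_nonpos fun v _ => hle v).1 hsum v (Finset.mem_univ v)⟩

end Flow

namespace CompactMetricGraph

variable {V E : Type*} (Γ : CompactMetricGraph V E)

/-! ### Elementary cuts -/

/-- The set whose part in the edge `e` is the interval `(p.1 e, p.2 e)`. -/
def segments (p : (E → ℝ) × (E → ℝ)) : E → Set ℝ := fun e => Ioo (p.1 e) (p.2 e)

/-- Pairs of end points of subintervals of the edges. -/
def segmentBox : Set ((E → ℝ) × (E → ℝ)) :=
  {p | ∀ e, 0 ≤ p.1 e ∧ p.1 e ≤ p.2 e ∧ p.2 e ≤ Γ.len e}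

/-- The elementary cuts are of two kinds: a vertex set `S` with all edges inside `S` and one point
on each edge leaving `S` (`Sum.inl S`), or a segment inside a single edge (`Sum.inr e`). -/
def elementaryCuts : Finset V ⊕ E → Set ((E → ℝ) × (E → ℝ))
  | Sum.inl S => Γ.segmentBox ∩ {p | ∀ e, (Γ.init e ∈ S → p.1 e = 0) ∧
      (Γ.term e ∈ S → p.2 e = Γ.len e) ∧ (Γ.init e ∉ S → Γ.term e ∉ S → p.1 e = p.2 e)}
  | Sum.inr e₀ => Γ.segmentBox ∩ {p | ∀ e, e ≠ e₀ → p.1 e = p.2 e}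

theorem elementaryCuts_subset (i : Finset V ⊕ E) : Γ.elementaryCuts i ⊆ Γ.segmentBox := by
  cases i <;> exact inter_subset_left

theorem isClosed_segmentBox : IsClosed Γ.segmentBox := by
  simp only [segmentBox, ofPred_forall, ofPred_and]
  refine isClosed_iInter fun e => ?_
  refine (isClosed_le ?_ ?_).inter ((isClosed_le ?_ ?_).inter (isClosed_le ?_ ?_)) <;> fun_prop

theorem isCompact_segmentBox : IsCompact Γ.segmentBox := by
  refine ((isCompact_Icc (a := (0 : E → ℝ)) (b := Γ.len)).prod
    (isCompact_Icc (a := (0 : E → ℝ)) (b := Γ.len))).of_isClosed_subset Γ.isClosed_segmentBox ?_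
  intro p hp
  exact ⟨⟨fun e => (hp e).1, fun e => (hp e).2.1.trans (hp e).2.2⟩,
    ⟨fun e => (hp e).1.trans (hp e).2.1, fun e => (hp e).2.2⟩⟩

theorem isCompact_elementaryCuts (i : Finset V ⊕ E) : IsCompact (Γ.elementaryCuts i) := by
  cases i with
  | inl S =>
    refine Γ.isCompact_segmentBox.inter_right ?_
    simp only [ofPred_forall, ofPred_and]
    refine isClosed_iInter fun e => (isClosed_iInter fun _ => ?_).inter
      ((isClosed_iInter fun _ => ?_).inter
        (isClosed_iInter fun _ => isClosed_iInter fun _ => ?_)) <;>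
    exact isClosed_eq (by fun_prop) (by fun_prop)
  | inr e₀ =>
    refine Γ.isCompact_segmentBox.inter_right ?_
    simp only [ofPred_forall]
    exact isClosed_iInter fun e => isClosed_iInter fun _ => isClosed_eq (by fun_prop) (by fun_prop)

theorem elementaryCuts_nonempty (i : Finset V ⊕ E) : (Γ.elementaryCuts i).Nonempty := by
  classical
  cases i with
  | inl S =>
    refine ⟨(fun _ => 0, fun e => if Γ.term e ∈ S then Γ.len e else 0), fun e => ?_, fun e => ?_⟩
    · have := (Γ.len_pos e).le
      dsimp only
      split_ifs <;> simp [this]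
    · refine ⟨fun _ => rfl, fun h => if_pos h, fun _ h => (if_neg h).symm⟩
  | inr e₀ =>
    exact ⟨(fun _ => 0, fun _ => 0), fun e => ⟨le_rfl, le_rfl, (Γ.len_pos e).le⟩,
      fun _ _ => rfl⟩

theorem isFinitePerimeter_segments {p : (E → ℝ) × (E → ℝ)} (hp : p ∈ Γ.segmentBox) :
    Γ.IsFinitePerimeter (segments p) where
  subset e := Ioo_subset_Ioo (hp e).1 (hp e).2.2
  measurable _ := measurableSet_Ioo.nullMeasurableSet
  memBV e := isBV_indicator_Ioo (hp e).1 (hp e).2.1 (hp e).2.2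

variable {Γ} in
theorem IsFinitePerimeter.compl {D : E → Set ℝ} (hD : Γ.IsFinitePerimeter D) :
    Γ.IsFinitePerimeter (Γ.compl D) where
  subset _ := sdiff_subset
  measurable e := measurableSet_Ioo.nullMeasurableSet.diff (hD.measurable e)
  memBV e := (hD.memBV e).indicator_diff (Γ.len_pos e).le (hD.subset e)

variable [Fintype E]

/-! ### Kirchhoff vector fields -/

/-- `outwardValue` sees only one end of an edge at `v`; the absence of loops ensures that nothing is
lost. -/
theorem sum_outwardValue_eq_netInflow [DecidableEq V] (z : E → ℝ → ℝ) (v : V) :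
    ∑ e ∈ Γ.incidentEdges v, Γ.outwardValue z e v = netInflow Γ.init Γ.term
      (fun e => z e (Γ.len e) - z e 0) (fun e => z e 0) v := by
  unfold incidentEdges outwardValue netInflow
  rw [Finset.sum_filter]
  refine Finset.sum_congr rfl fun e _ => ?_
  have hne := Γ.no_loops e
  by_cases ht : Γ.term e = v
  · have hi : Γ.init e ≠ v := fun hi => hne (hi.trans ht.symm)
    simp [ht, hi]
  · by_cases hi : Γ.init e = v <;> simp [ht, hi]

variable {Γ} in
theorem IsKirchhoff.sum_boundary_eq_zero [DecidableEq V] {z w : E → ℝ → ℝ}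
    (h : Γ.IsKirchhoff z w) (S : Finset V) :
    ∑ e, ((if Γ.term e ∈ S then z e (Γ.len e) else 0) - if Γ.init e ∈ S then z e 0 else 0) = 0 := by
  have := sum_netInflow Γ.init Γ.term (fun e => z e (Γ.len e) - z e 0) (fun e => z e 0) S
  simp only [← sum_outwardValue_eq_netInflow, h.kirchhoff, Finset.sum_const_zero,
    add_sub_cancel] at this
  exact this.symm

variable {Γ} in
theorem IsKirchhoff.integral_deriv_eq_zero [Fintype V] {z w : E → ℝ → ℝ}
    (h : Γ.IsKirchhoff z w) : Γ.integral w = 0 := by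
  classical
  rw [← h.sum_boundary_eq_zero Finset.univ]
  refine Finset.sum_congr rfl fun e _ => ?_
  have hl := Γ.len_pos e
  rw [integral_Ioo_eq_intervalIntegral hl.le, (h.sobolev e).integral_deriv hl ⟨le_rfl, hl.le⟩
    ⟨hl.le, le_rfl⟩]
  simp

/-! ### Mass and boundary of elementary cuts -/

/-- The total length of `segments p`. -/
def segmentsLength (p : (E → ℝ) × (E → ℝ)) : ℝ := ∑ e, (p.2 e - p.1 e)

/-- The smaller one of the lengths of `segments p` and of its complement. -/
def cutMass (p : (E → ℝ) × (E → ℝ)) : ℝ :=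
  min (segmentsLength p) (∑ e, Γ.len e - segmentsLength p)

open Classical in
/-- The number of boundary points of an elementary cut. -/
noncomputable def boundaryCount : Finset V ⊕ E → ℝ
  | Sum.inl S => ∑ e, if Γ.init e ∈ S ↔ Γ.term e ∈ S then 0 else 1
  | Sum.inr _ => 2

theorem boundaryCount_nonneg (i : Finset V ⊕ E) : 0 ≤ Γ.boundaryCount i := by
  cases i with
  | inl S => exact Finset.sum_nonneg fun e _ => by split_ifs <;> norm_num
  | inr e => exact zero_le_two

theorem continuous_cutMass : Continuous Γ.cutMass := by
  unfold cutMass segmentsLength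
  fun_prop

variable {Γ} in
theorem cutMass_nonneg {p : (E → ℝ) × (E → ℝ)} (hp : p ∈ Γ.segmentBox) : 0 ≤ Γ.cutMass p := by
  refine le_min (Finset.sum_nonneg fun e _ => by linarith [hp e]) (sub_nonneg.2 ?_)
  exact Finset.sum_le_sum fun e _ => by linarith [hp e]

/-- Half of an edge has positive length, and so does the rest of the graph. -/
theorem exists_elementaryCut_cutMass_pos (e₀ : E) :
    ∃ p ∈ Γ.elementaryCuts (Sum.inr e₀), 0 < Γ.cutMass p := by
  classical
  refine ⟨(fun _ => 0, fun e => if e = e₀ then Γ.len e / 2 else 0), ⟨fun e => ?_, fun e he => ?_⟩,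
    ?_⟩
  · have := Γ.len_pos e
    dsimp only
    split_ifs <;> refine ⟨le_rfl, by linarith, by linarith⟩
  · simp [he]
  · have h0 := Γ.len_pos e₀
    have h1 : Γ.len e₀ ≤ ∑ e, Γ.len e :=
      Finset.single_le_sum (fun e _ => (Γ.len_pos e).le) (Finset.mem_univ e₀)
    simp only [cutMass, segmentsLength, sub_zero, Finset.sum_ite_eq', Finset.mem_univ, if_true]
    exact lt_min (by linarith) (by linarith)

/-- There is an elementary cut with the least ratio of boundary points to mass. -/
theorem exists_optimal_elementaryCut [Fintype V] [Nonempty E] :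
    ∃ i, ∃ p ∈ Γ.elementaryCuts i, 0 < Γ.cutMass p ∧ ∀ j, ∀ q ∈ Γ.elementaryCuts j,
      Γ.boundaryCount i / Γ.cutMass p * Γ.cutMass q ≤ Γ.boundaryCount j := by
  classical
  -- The boundary count depends only on the kind `i`, so within a kind the best ratio has the
  -- largest mass; kinds of zero mass satisfy the inequality trivially.
  have hmax : ∀ i, ∃ p ∈ Γ.elementaryCuts i, ∀ q ∈ Γ.elementaryCuts i,
      Γ.cutMass q ≤ Γ.cutMass p := fun i =>
    (Γ.isCompact_elementaryCuts i).exists_isMaxOn (Γ.elementaryCuts_nonempty i)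
      Γ.continuous_cutMass.continuousOn
  choose P hP hPmax using hmax
  have hne : (Finset.univ.filter fun i => 0 < Γ.cutMass (P i)).Nonempty := by
    obtain ⟨e₀⟩ := ‹Nonempty E›
    obtain ⟨p, hp, hpos⟩ := Γ.exists_elementaryCut_cutMass_pos e₀
    exact ⟨Sum.inr e₀, by simpa using hpos.trans_le (hPmax _ p hp)⟩
  obtain ⟨i, hi, hmin⟩ := Finset.exists_min_image _
    (fun i => Γ.boundaryCount i / Γ.cutMass (P i)) hne
  simp only [Finset.mem_filter, Finset.mem_univ, true_and] at hi hmin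
  refine ⟨i, P i, hP i, hi, fun j q hq => ?_⟩
  have hq0 := cutMass_nonneg (Γ.elementaryCuts_subset j hq)
  have hr0 : 0 ≤ Γ.boundaryCount i / Γ.cutMass (P i) :=
    div_nonneg (Γ.boundaryCount_nonneg i) hi.le
  rcases lt_or_ge 0 (Γ.cutMass (P j)) with hj | hj
  · exact (mul_le_mul_of_nonneg_left (hPmax j q hq) hr0).trans
      ((le_div_iff₀ hj).1 (hmin j hj))
  · have : Γ.cutMass q = 0 := le_antisymm ((hPmax j q hq).trans hj) hq0
    rw [this, mul_zero]
    exact Γ.boundaryCount_nonneg j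

variable {Γ} in
-- For a vertex set `S`, subtracting the Kirchhoff sum over `S` cancels all values at vertices,
-- leaving one value of `z` per cut point. A segment simply has two end points.
theorem IsKirchhoff.abs_sum_sub_le_boundaryCount {z w : E → ℝ → ℝ} (h : Γ.IsKirchhoff z w)
    (hz : ∀ e, ∀ x ∈ Icc 0 (Γ.len e), |z e x| ≤ 1) {i : Finset V ⊕ E} {p : (E → ℝ) × (E → ℝ)}
    (hp : p ∈ Γ.elementaryCuts i) :
    |∑ e, (z e (p.2 e) - z e (p.1 e))| ≤ Γ.boundaryCount i := by
  classical
  have hbox := Γ.elementaryCuts_subset i hp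
  have h1 : ∀ e, |z e (p.1 e)| ≤ 1 := fun e =>
    hz e _ ⟨(hbox e).1, (hbox e).2.1.trans (hbox e).2.2⟩
  have h2 : ∀ e, |z e (p.2 e)| ≤ 1 := fun e =>
    hz e _ ⟨(hbox e).1.trans (hbox e).2.1, (hbox e).2.2⟩
  cases i with
  | inl S =>
    have hS := h.sum_boundary_eq_zero S
    rw [← sub_zero (∑ e, (z e (p.2 e) - z e (p.1 e))), ← hS, ← Finset.sum_sub_distrib]
    refine (Finset.abs_sum_le_sum_abs _ _).trans (Finset.sum_le_sum fun e _ => ?_)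
    obtain ⟨hi, ht, hn⟩ := hp.2 e
    by_cases hti : Γ.term e ∈ S <;> by_cases hii : Γ.init e ∈ S
    · simp [hti, hii, hi hii, ht hti]
    · simpa [hti, hii, ht hti] using h1 e
    · simpa [hti, hii, hi hii] using h2 e
    · simp [hti, hii, hn hii hti]
  | inr e₀ =>
    rw [Finset.sum_eq_single e₀ (fun e _ he => by rw [hp.2 e he, sub_self]) (by simp)]
    refine (abs_sub _ _).trans ?_
    show _ ≤ (2 : ℝ)
    linarith [h1 e₀, h2 e₀]

theorem integral_char_segments_mul {p : (E → ℝ) × (E → ℝ)} (hp : p ∈ Γ.segmentBox)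
    (w : E → ℝ → ℝ) :
    (Γ.integral fun e x => char (segments p) e x * w e x) =
      ∑ e, ∫ x in (p.1 e)..(p.2 e), w e x := by
  refine Finset.sum_congr rfl fun e _ => ?_
  have hmul : (fun x => char (segments p) e x * w e x) =
      (Ioo (p.1 e) (p.2 e)).indicator (w e) := by
    ext x
    by_cases hx : x ∈ Ioo (p.1 e) (p.2 e) <;> simp [char, segments, hx]
  rw [hmul, setIntegral_indicator measurableSet_Ioo,
    inter_eq_self_of_subset_right (Ioo_subset_Ioo (hp e).1 (hp e).2.2),
    ← integral_Ioc_eq_integral_Ioo, ← intervalIntegral.integral_of_le (hp e).2.1]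

theorem perimeter_segments_le {i : Finset V ⊕ E} {p : (E → ℝ) × (E → ℝ)}
    (hp : p ∈ Γ.elementaryCuts i) :
    Γ.perimeter (segments p) ≤ ENNReal.ofReal (Γ.boundaryCount i) := by
  have hbox := Γ.elementaryCuts_subset i hp
  refine iSup_le fun z => iSup_le fun w => iSup_le fun h => iSup_le fun hz =>
    ENNReal.ofReal_le_ofReal ?_
  rw [Γ.integral_char_segments_mul hbox]
  have hz' : ∀ e, ∀ x ∈ Icc 0 (Γ.len e), |z e x| ≤ 1 := fun e =>
    abs_le_one_of_eLpNorm_le_one (Γ.len_pos e) (h.sobolev e).continuousOn (hz e)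
  have hftc : ∑ e, ∫ x in (p.1 e)..(p.2 e), w e x = ∑ e, (z e (p.2 e) - z e (p.1 e)) :=
    Finset.sum_congr rfl fun e _ => (h.sobolev e).integral_deriv (Γ.len_pos e)
      ⟨(hbox e).1, (hbox e).2.1.trans (hbox e).2.2⟩ ⟨(hbox e).1.trans (hbox e).2.1, (hbox e).2.2⟩
  rw [hftc]
  exact h.abs_sum_sub_le_boundaryCount hz' hp

variable {Γ} in
theorem length_segments {p : (E → ℝ) × (E → ℝ)} (hp : p ∈ Γ.segmentBox) :
    length (segments p) = ENNReal.ofReal (segmentsLength p) := by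
  simp only [length, segments, segmentsLength, Real.volume_Ioo]
  rw [ENNReal.ofReal_sum_of_nonneg fun e _ => by linarith [hp e]]

/-! ### Complements -/

theorem totalLength_eq_ofReal : Γ.totalLength = ENNReal.ofReal (∑ e, Γ.len e) := by
  rw [ENNReal.ofReal_sum_of_nonneg fun e _ => (Γ.len_pos e).le]
  rfl

variable {Γ}

theorem IsFinitePerimeter.length_add_length_compl {D : E → Set ℝ} (hD : Γ.IsFinitePerimeter D) :
    length D + length (Γ.compl D) = Γ.totalLength := by
  simp only [length, totalLength, CompactMetricGraph.compl, ← Finset.sum_add_distrib]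
  refine Finset.sum_congr rfl fun e _ => ?_
  rw [← measure_union₀ (measurableSet_Ioo.nullMeasurableSet.diff (hD.measurable e))
    disjoint_sdiff_right.aedisjoint, union_sdiff_cancel (hD.subset e), Real.volume_Ioo, sub_zero]

/-- Kirchhoff fields have derivatives of total integral zero, so the integrals over `D` and over its
complement are opposite. -/
theorem IsFinitePerimeter.perimeter_compl_le [Fintype V] {D : E → Set ℝ}
    (hD : Γ.IsFinitePerimeter D) : Γ.perimeter (Γ.compl D) ≤ Γ.perimeter D := by
  refine iSup_le fun z => iSup_le fun w => iSup_le fun h => iSup_le fun hz => ?_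
  have heq : (Γ.integral fun e x => char (Γ.compl D) e x * w e x) =
      -Γ.integral fun e x => char D e x * w e x := by
    rw [← zero_sub, ← h.integral_deriv_eq_zero]
    unfold integral
    rw [← Finset.sum_sub_distrib]
    refine Finset.sum_congr rfl fun e _ => ?_
    have hw := (h.sobolev e).integrableOn_deriv
    have hDw : IntegrableOn (fun x => char D e x * w e x) (Ioo 0 (Γ.len e)) := by
      refine Integrable.bdd_mul (c := 1) hw (hD.memBV e).1.aestronglyMeasurable
        (Filter.Eventually.of_forall fun x => ?_)
      by_cases hx : x ∈ D e <;> simp [char, hx]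
    rw [← integral_sub hw hDw]
    refine setIntegral_congr_fun measurableSet_Ioo fun x hx => ?_
    have hx' : 0 < x ∧ x < Γ.len e := hx
    by_cases hxD : x ∈ D e <;> simp [char, CompactMetricGraph.compl, hxD, hx']
  rw [heq, abs_neg]
  exact le_iSup_of_le z (le_iSup_of_le w (le_iSup_of_le h (le_iSup_of_le hz le_rfl)))

/-! ### Calibrations -/

/-- As `s` has mean zero, its integral over the segments is minus that over the complement; `|s| ≤
1` bounds it by either length. -/
theorem abs_sum_integral_le_cutMass {s : E → ℝ → ℝ}
    (hs : ∀ e, IntegrableOn (s e) (Ioo 0 (Γ.len e))) (hs1 : ∀ e x, |s e x| ≤ 1)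
    (hmean : Γ.integral s = 0) {p : (E → ℝ) × (E → ℝ)} (hp : p ∈ Γ.segmentBox) :
    |∑ e, ∫ x in (p.1 e)..(p.2 e), s e x| ≤ Γ.cutMass p := by
  have hbound : ∀ e a b, a ≤ b → |∫ x in a..b, s e x| ≤ b - a := by
    intro e a b hab
    have := intervalIntegral.norm_integral_le_of_norm_le_const (a := a) (b := b) (f := s e)
      (C := 1) fun x _ => hs1 e x
    rwa [one_mul, abs_of_nonneg (sub_nonneg.2 hab)] at this
  refine le_min ?_ ?_
  · exact (Finset.abs_sum_le_sum_abs _ _).trans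
      (Finset.sum_le_sum fun e _ => hbound e _ _ (hp e).2.1)
  · have hsplit : ∑ e, ∫ x in (p.1 e)..(p.2 e), s e x =
        -∑ e, ((∫ x in (0 : ℝ)..(p.1 e), s e x) + ∫ x in (p.2 e)..(Γ.len e), s e x) := by
      rw [eq_neg_iff_add_eq_zero, ← Finset.sum_add_distrib]
      refine Eq.trans ?_ hmean
      refine Finset.sum_congr rfl fun e _ => ?_
      have hl := (Γ.len_pos e).le
      obtain ⟨h1, h2, h3⟩ := hp e
      have m0 : (0 : ℝ) ∈ Icc 0 (Γ.len e) := ⟨le_rfl, hl⟩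
      have m1 : p.1 e ∈ Icc 0 (Γ.len e) := ⟨h1, h2.trans h3⟩
      have m2 : p.2 e ∈ Icc 0 (Γ.len e) := ⟨h1.trans h2, h3⟩
      have m3 : Γ.len e ∈ Icc 0 (Γ.len e) := ⟨hl, le_rfl⟩
      rw [integral_Ioo_eq_intervalIntegral hl, ← intervalIntegral.integral_add_adjacent_intervals
        ((hs e).intervalIntegrable_of_mem_Icc m0 m1) ((hs e).intervalIntegrable_of_mem_Icc m1 m3),
        ← intervalIntegral.integral_add_adjacent_intervals
        ((hs e).intervalIntegrable_of_mem_Icc m1 m2) ((hs e).intervalIntegrable_of_mem_Icc m2 m3)]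
      ring
    rw [hsplit, abs_neg, segmentsLength, ← Finset.sum_sub_distrib]
    refine (Finset.abs_sum_le_sum_abs _ _).trans (Finset.sum_le_sum fun e _ => ?_)
    refine (abs_add_le _ _).trans ?_
    have := hbound e _ _ (hp e).1
    have := hbound e _ _ (hp e).2.2
    linarith

/-- If `c * cutMass ≤ boundaryCount` for all elementary cuts, then every function of mean zero
bounded by `1` is, up to the factor `c`, the derivative of a Kirchhoff vector field bounded
by `1`. -/
theorem exists_isKirchhoff [Fintype V] {c : ℝ} (hc : 0 ≤ c)
    (hcut : ∀ i, ∀ p ∈ Γ.elementaryCuts i, c * Γ.cutMass p ≤ Γ.boundaryCount i)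
    {s : E → ℝ → ℝ} (hs : ∀ e, AEStronglyMeasurable (s e) (volume.restrict (Ioo 0 (Γ.len e))))
    (hs1 : ∀ e x, |s e x| ≤ 1) (hmean : Γ.integral s = 0) :
    ∃ z, Γ.IsKirchhoff z (fun e x => c * s e x) ∧
      ∀ e, eLpNorm (z e) ∞ (volume.restrict (Ioo 0 (Γ.len e))) ≤ 1 := by
  classical
  have hsi : ∀ e, IntegrableOn (s e) (Ioo 0 (Γ.len e)) := fun e =>
    memLp_one_iff_integrable.1 (MemLp.of_bound (hs e) 1 (Filter.Eventually.of_forall (hs1 e)))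
  have hmass : ∀ i, ∀ p ∈ Γ.elementaryCuts i,
      c * |∑ e, ∫ x in (p.1 e)..(p.2 e), s e x| ≤ Γ.boundaryCount i := fun i p hp =>
    (mul_le_mul_of_nonneg_left (abs_sum_integral_le_cutMass hsi hs1 hmean
      (Γ.elementaryCuts_subset i hp)) hc).trans (hcut i p hp)
  have hsob : ∀ r e, IsSobolev (Γ.len e) (fun x => r + ∫ t in (0 : ℝ)..x, c * s e t)
      (fun x => c * s e x) := fun r e =>
    isSobolev_primitive (C := c) (Γ.len_pos e).le ((hs e).const_mul c) (fun x => by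
      rw [abs_mul, abs_of_nonneg hc]
      exact mul_le_of_le_one_right hc (hs1 e x)) r
  set G : E → ℝ → ℝ := fun e x => ∫ t in (0 : ℝ)..x, c * s e t with hG
  have hG0 : ∀ e, G e 0 = 0 := fun e => intervalIntegral.integral_same
  have hGcont : ∀ e, ContinuousOn (G e) (Icc 0 (Γ.len e)) := fun e => by
    simpa [hG] using (hsob 0 e).continuousOn
  have hGsub : ∀ e, ∀ a ∈ Icc 0 (Γ.len e), ∀ b ∈ Icc 0 (Γ.len e),
      G e b - G e a = c * ∫ x in a..b, s e x := by
    intro e a ha b hb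
    have m0 : (0 : ℝ) ∈ Icc 0 (Γ.len e) := ⟨le_rfl, (Γ.len_pos e).le⟩
    rw [← intervalIntegral.integral_const_mul]
    exact intervalIntegral.integral_interval_sub_left
      (((hsi e).intervalIntegrable_of_mem_Icc m0 hb).const_mul c)
      (((hsi e).intervalIntegrable_of_mem_Icc m0 ha).const_mul c)
  have hne : ∀ e, (Icc 0 (Γ.len e)).Nonempty := fun e => nonempty_Icc.2 (Γ.len_pos e).le
  choose lo hlo hlomin using fun e => isCompact_Icc.exists_isMinOn (hne e) (hGcont e)
  choose hi hhi hhimax using fun e => isCompact_Icc.exists_isMaxOn (hne e) (hGcont e)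
  -- `f e + G e` stays in `[-1, 1]` exactly when `f e` lies between `-1 - min G e` and `1 - max G
  -- e`. That interval is nonempty by the inequality for the segment between `lo e` and `hi e`.
  have hgap : ∀ e, G e (hi e) - G e (lo e) ≤ 2 := by
    intro e₀
    rw [hGsub e₀ _ (hlo e₀) _ (hhi e₀)]
    have hseg : ∀ a b, 0 ≤ a → a ≤ b → b ≤ Γ.len e₀ → c * |∫ x in a..b, s e₀ x| ≤ 2 := by
      intro a b ha hab hb
      have := hmass (Sum.inr e₀) (fun e => if e = e₀ then a else 0, fun e => if e = e₀ then b else 0)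
        ⟨fun e => by
          by_cases he : e = e₀
          · subst he
            simp [ha, hab, hb]
          · simp [he, (Γ.len_pos e).le], fun e he => by simp [he]⟩
      rw [Finset.sum_eq_single e₀ (fun e _ he => by simp [he]) (by simp)] at this
      simpa [boundaryCount] using this
    rcases le_total (lo e₀) (hi e₀) with h | h
    · exact (mul_le_mul_of_nonneg_left (le_abs_self _) hc).trans
        (hseg _ _ (hlo e₀).1 h (hhi e₀).2)
    · rw [intervalIntegral.integral_symm]
      exact (mul_le_mul_of_nonneg_left (neg_le_abs _) hc).trans
        (hseg _ _ (hhi e₀).1 h (hlo e₀).2)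
  obtain ⟨f, hf, hbal⟩ := exists_netInflow_eq_zero Γ.init Γ.term (fun e => -1 - G e (lo e))
    (fun e => 1 - G e (hi e)) (fun e => G e (Γ.len e)) (fun e => by linarith [hgap e])
    (by
      have : ∑ e, G e (Γ.len e) = c * Γ.integral s := by
        unfold integral
        rw [Finset.mul_sum]
        refine Finset.sum_congr rfl fun e _ => ?_
        rw [integral_Ioo_eq_intervalIntegral (Γ.len_pos e).le,
          ← intervalIntegral.integral_const_mul]
      rw [this, hmean, mul_zero])
    (by
      intro S
      -- The worst cut for `S`: edges entering `S` are cut at the minimum of `G e`, edges leaving it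
      -- at the maximum. Its inequality is then Hoffman's condition term by term.
      let p : (E → ℝ) × (E → ℝ) := (fun e => if Γ.init e ∈ S then 0 else
        if Γ.term e ∈ S then lo e else 0, fun e => if Γ.term e ∈ S then Γ.len e else
        if Γ.init e ∈ S then hi e else 0)
      have hp : p ∈ Γ.elementaryCuts (Sum.inl S) := by
        refine ⟨fun e => ?_, fun e => ?_⟩
        · have h1 := hlo e
          have h2 := hhi e
          have h3 := (Γ.len_pos e).le
          by_cases hii : Γ.init e ∈ S <;> by_cases hti : Γ.term e ∈ S <;>
            simp [p, hii, hti, h1.1, h1.2, h2.1, h2.2, h3]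
        · refine ⟨fun h => by simp [p, h], fun h => by simp [p, h], fun h h' => by simp [p, h, h']⟩
      have hle := (mul_le_mul_of_nonneg_left (le_abs_self _) hc).trans (hmass _ p hp)
      rw [Finset.mul_sum] at hle
      have hbc : Γ.boundaryCount (Sum.inl S) =
        ∑ e, if Γ.init e ∈ S ↔ Γ.term e ∈ S then (0 : ℝ) else 1 := rfl
      rw [hbc, ← sub_nonpos, ← Finset.sum_sub_distrib] at hle
      refine (Finset.sum_le_sum fun e _ => ?_).trans hle
      have hbox := Γ.elementaryCuts_subset _ hp e
      rw [← hGsub e _ ⟨hbox.1, hbox.2.1.trans hbox.2.2⟩ _ ⟨hbox.1.trans hbox.2.1, hbox.2.2⟩]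
      refine le_of_eq ?_
      by_cases hii : Γ.init e ∈ S <;> by_cases hti : Γ.term e ∈ S <;>
        (simp [p, hii, hti, hG0]; try ring))
  refine ⟨fun e x => f e + G e x, ⟨fun e => hsob (f e) e, fun v => ?_⟩, fun e => ?_⟩
  · rw [sum_outwardValue_eq_netInflow]
    refine Eq.trans ?_ (hbal v)
    simp [hG0]
  · refine eLpNorm_exponent_top.trans_le (eLpNormEssSup_le_of_ae_enorm_bound ?_)
    filter_upwards [ae_restrict_mem measurableSet_Ioo] with x hx
    have hx' := Ioo_subset_Icc_self hx
    have h1 : G e (lo e) ≤ G e x := hlomin e hx'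
    have h2 : G e x ≤ G e (hi e) := hhimax e hx'
    rw [Real.enorm_eq_ofReal_abs, ENNReal.ofReal_le_one]
    have := (hf e).1
    have := (hf e).2
    exact abs_le.2 ⟨by linarith, by linarith⟩

theorem ofReal_mul_integral_le_totalVariation [Fintype V] {c : ℝ} (hc : 0 ≤ c)
    (hcut : ∀ i, ∀ p ∈ Γ.elementaryCuts i, c * Γ.cutMass p ≤ Γ.boundaryCount i)
    {s : E → ℝ → ℝ} (hs : ∀ e, AEStronglyMeasurable (s e) (volume.restrict (Ioo 0 (Γ.len e))))
    (hs1 : ∀ e x, |s e x| ≤ 1) (hmean : Γ.integral s = 0) (u : E → ℝ → ℝ) :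
    ENNReal.ofReal (c * Γ.integral fun e x => u e x * s e x) ≤ Γ.totalVariation u := by
  obtain ⟨z, hz, hz1⟩ := exists_isKirchhoff hc hcut hs hs1 hmean
  refine le_iSup_of_le z (le_iSup_of_le _ (le_iSup_of_le hz (le_iSup_of_le hz1 ?_)))
  refine ENNReal.ofReal_le_ofReal (le_trans (le_of_eq ?_) (le_abs_self _))
  unfold integral
  rw [Finset.mul_sum]
  refine Finset.sum_congr rfl fun e _ => ?_
  rw [← integral_const_mul]
  congr 1
  ext x
  ring

end CompactMetricGraph

theorem integral_ite_pos_neg {μ : Measure ℝ} [IsFiniteMeasure μ] {u : ℝ → ℝ}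
    (hu : AEMeasurable u μ) (a b c : ℝ) :
    ∫ x, (if 0 < u x then a else if u x < 0 then b else c) ∂μ =
      a * μ.real {x | 0 < u x} + b * μ.real {x | u x < 0} + c * μ.real {x | u x = 0} := by
  have h1 : NullMeasurableSet {x | 0 < u x} μ := nullMeasurableSet_lt aemeasurable_const hu
  have h2 : NullMeasurableSet {x | u x < 0} μ := nullMeasurableSet_lt hu aemeasurable_const
  have h3 : NullMeasurableSet {x | u x = 0} μ := nullMeasurableSet_eq_fun hu aemeasurable_const
  have hi : ∀ (A : Set ℝ) (r : ℝ), NullMeasurableSet A μ →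
      Integrable (A.indicator fun _ => r) μ := fun A r hA =>
    (integrable_const r).indicator₀ hA
  have hv : ∀ (A : Set ℝ) (r : ℝ), NullMeasurableSet A μ →
      ∫ x, A.indicator (fun _ => r) x ∂μ = r * μ.real A := fun A r hA => by
    rw [integral_indicator₀ hA, setIntegral_const, smul_eq_mul, mul_comm]
  rw [← hv _ a h1, ← hv _ b h2, ← hv _ c h3, ← integral_add (hi _ _ h1) (hi _ _ h2),
    ← integral_add (by exact (hi _ _ h1).add (hi _ _ h2)) (hi _ _ h3)]
  congr 1
  ext x
  rcases lt_trichotomy (u x) 0 with h | h | h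
  · simp [h, h.ne, h.not_gt]
  · simp [h]
  · simp [h, h.ne', h.not_gt]

namespace CompactMetricGraph

variable {V E : Type*} [Fintype E] {Γ : CompactMetricGraph V E}

/-! ### Lower bounds -/

/-- Test with `s = 1` on `{u > 0}`, `-1` on `{u < 0}` and the constant `(N - P) / Z` on `{u = 0}`.
This constant gives mean zero without affecting `u * s = |u|`, and the median condition is what
bounds it by `1`. -/
theorem Admissible.ofReal_le_totalVariation [Fintype V] {c : ℝ} (hc : 0 ≤ c)
    (hcut : ∀ i, ∀ p ∈ Γ.elementaryCuts i, c * Γ.cutMass p ≤ Γ.boundaryCount i)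
    {u : E → ℝ → ℝ} (hu : Γ.Admissible u) : ENNReal.ofReal c ≤ Γ.totalVariation u := by
  have hum : ∀ e, AEMeasurable (u e) (volume.restrict (Ioo 0 (Γ.len e))) := fun e =>
    (hu.memBV e).1.aemeasurable
  set P := ∑ e, (volume.restrict (Ioo 0 (Γ.len e))).real {x | 0 < u e x} with hP
  set N := ∑ e, (volume.restrict (Ioo 0 (Γ.len e))).real {x | u e x < 0} with hN
  set Z := ∑ e, (volume.restrict (Ioo 0 (Γ.len e))).real {x | u e x = 0} with hZ
  have hint : ∀ a b k : ℝ, (Γ.integral fun e x => if 0 < u e x then a else if u e x < 0 then b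
      else k) = a * P + b * N + k * Z := by
    intro a b k
    simp only [hP, hN, hZ, Finset.mul_sum, ← Finset.sum_add_distrib]
    exact Finset.sum_congr rfl fun e _ => integral_ite_pos_neg (hum e) a b k
  have htotal : P + N + Z = ∑ e, Γ.len e := by
    have := hint 1 1 1
    simp only [ite_self, one_mul] at this
    rw [← this]
    exact Finset.sum_congr rfl fun e _ => by simp [(Γ.len_pos e).le]
  have hZ0 : 0 ≤ Z := Finset.sum_nonneg fun e _ => measureReal_nonneg
  have hL0 : 0 ≤ ∑ e, Γ.len e := Finset.sum_nonneg fun e _ => (Γ.len_pos e).le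
  have hconv : ∀ A : E → Set ℝ,
      length (fun e => A e ∩ Ioo 0 (Γ.len e)) ≤ Γ.totalLength / 2 →
      ∑ e, (volume.restrict (Ioo 0 (Γ.len e))).real (A e) ≤ (∑ e, Γ.len e) / 2 := by
    intro A hA
    have h1 : length (fun e => A e ∩ Ioo 0 (Γ.len e)) = ENNReal.ofReal
        (∑ e, (volume.restrict (Ioo 0 (Γ.len e))).real (A e)) := by
      rw [ENNReal.ofReal_sum_of_nonneg fun e _ => measureReal_nonneg]
      refine Finset.sum_congr rfl fun e _ => ?_
      rw [ofReal_measureReal, Measure.restrict_apply' measurableSet_Ioo]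
    rw [h1, totalLength_eq_ofReal, show (2 : ℝ≥0∞) = ENNReal.ofReal 2 by simp,
      ← ENNReal.ofReal_div_of_pos two_pos, ENNReal.ofReal_le_ofReal_iff (by positivity)] at hA
    exact hA
  have hset : ∀ (e : E) (q : ℝ → Prop), {x | q x} ∩ Ioo 0 (Γ.len e) =
      {x ∈ Ioo 0 (Γ.len e) | q x} := fun e q => by
    ext x
    exact and_comm
  have hNle : N ≤ (∑ e, Γ.len e) / 2 := by
    refine hconv _ ?_
    simp only [hset]
    exact hu.median.1
  have hPle : P ≤ (∑ e, Γ.len e) / 2 := by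
    refine hconv _ ?_
    simp only [hset]
    exact hu.median.2
  have hNP : |N - P| ≤ Z := abs_le.2 ⟨by linarith, by linarith⟩
  have hk : |(N - P) / Z| ≤ 1 := by
    rw [abs_div, abs_of_nonneg hZ0]
    exact div_le_one_of_le₀ hNP hZ0
  -- If `Z = 0` the quotient is `0` by convention, but then `hNP` forces `N = P`.
  have hkZ : (N - P) / Z * Z = N - P := by
    rcases hZ0.eq_or_lt with h | h
    · rw [← h] at hNP ⊢
      rw [mul_zero, abs_nonpos_iff.1 hNP]
    · exact div_mul_cancel₀ _ h.ne'
  have hmeas : Measurable fun y : ℝ => if 0 < y then (1 : ℝ) else if y < 0 then -1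
      else (N - P) / Z :=
    Measurable.ite measurableSet_Ioi measurable_const
      (Measurable.ite measurableSet_Iio measurable_const measurable_const)
  have key := ofReal_mul_integral_le_totalVariation hc hcut
    (s := fun e x => if 0 < u e x then 1 else if u e x < 0 then -1 else (N - P) / Z)
    (fun e => (hmeas.comp_aemeasurable (hum e)).aestronglyMeasurable)
    (fun e x => by split_ifs <;> simp [hk])
    (by rw [hint, hkZ]; ring) u
  have habs : (Γ.integral fun e x => u e x * if 0 < u e x then 1 else if u e x < 0 then -1
      else (N - P) / Z) = 1 := by
    refine Eq.trans ?_ hu.norm_eq_one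
    congr 1
    ext e x
    rcases lt_trichotomy (u e x) 0 with h | h | h
    · simp [h, h.not_gt, abs_of_neg h]
    · simp [h]
    · simp [h, abs_of_pos h]
  rwa [habs, mul_one] at key

theorem IsFinitePerimeter.integral_char {D : E → Set ℝ} (hD : Γ.IsFinitePerimeter D) :
    Γ.integral (char D) = (length D).toReal := by
  have hfin : ∀ e, volume (D e) ≠ ⊤ := fun e =>
    ((measure_mono (hD.subset e)).trans_lt measure_Ioo_lt_top).ne
  rw [length, ENNReal.toReal_sum fun e _ => hfin e]
  refine Finset.sum_congr rfl fun e _ => ?_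
  have hr := (hD.measurable e).mono (Measure.restrict_le_self (s := Ioo 0 (Γ.len e)))
  unfold char
  rw [integral_indicator₀ hr, setIntegral_const, smul_eq_mul, mul_one, measureReal_def,
    Measure.restrict_apply' measurableSet_Ioo, inter_eq_self_of_subset_left (hD.subset e)]

theorem IsFinitePerimeter.integral_mul_char_add {D : E → Set ℝ} (hD : Γ.IsFinitePerimeter D)
    (a b : ℝ) : (Γ.integral fun e x => a * char D e x + b) =
      a * (length D).toReal + b * ∑ e, Γ.len e := by
  rw [← hD.integral_char]
  unfold integral
  rw [Finset.mul_sum, Finset.mul_sum, ← Finset.sum_add_distrib]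
  refine Finset.sum_congr rfl fun e _ => ?_
  rw [integral_add ((hD.memBV e).1.const_mul a) (integrable_const b), integral_const_mul]
  simp [(Γ.len_pos e).le, mul_comm]

/-- With `a`, `b` the lengths of `D` and its complement and `m = min a b`, test with `s = m / a` on
`D` and `-m / b` off `D`: it has mean zero, is bounded by `1` and integrates to `m` over `D`. -/
theorem IsFinitePerimeter.ofReal_le_perimeter_div [Fintype V] {c : ℝ} (hc : 0 ≤ c)
    (hcut : ∀ i, ∀ p ∈ Γ.elementaryCuts i, c * Γ.cutMass p ≤ Γ.boundaryCount i)
    {D : E → Set ℝ} (hD : Γ.IsFinitePerimeter D) (h0 : 0 < length D)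
    (h1 : length D < Γ.totalLength) :
    ENNReal.ofReal c ≤ Γ.perimeter D / min (length D) (length (Γ.compl D)) := by
  classical
  have hadd := hD.length_add_length_compl
  have hT : Γ.totalLength ≠ ⊤ := by rw [totalLength_eq_ofReal]; exact ENNReal.ofReal_ne_top
  have hfin : length D ≠ ⊤ := h1.ne_top
  have hfin' : length (Γ.compl D) ≠ ⊤ := fun h => by simp [h] at hadd; exact hT hadd.symm
  have hpos' : 0 < length (Γ.compl D) := by
    rw [pos_iff_ne_zero]
    intro h
    rw [h, add_zero] at hadd
    exact h1.ne hadd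
  have hL0 : 0 ≤ ∑ e, Γ.len e := Finset.sum_nonneg fun e _ => (Γ.len_pos e).le
  set a := (length D).toReal with ha
  set b := (length (Γ.compl D)).toReal with hb
  have ha0 : 0 < a := ENNReal.toReal_pos h0.ne' hfin
  have hb0 : 0 < b := ENNReal.toReal_pos hpos'.ne' hfin'
  have hab : a + b = ∑ e, Γ.len e := by
    rw [ha, hb, ← ENNReal.toReal_add hfin hfin', hadd, totalLength_eq_ofReal,
      ENNReal.toReal_ofReal hL0]
  have hmin : min (length D) (length (Γ.compl D)) = ENNReal.ofReal (min a b) := by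
    rw [ENNReal.ofReal_min, ENNReal.ofReal_toReal hfin, ENNReal.ofReal_toReal hfin']
  have hm0 : 0 < min a b := lt_min ha0 hb0
  have hval : ∀ e x, (min a b / a + min a b / b) * char D e x + -(min a b / b) =
      if x ∈ D e then min a b / a else -(min a b / b) := by
    intro e x
    by_cases hx : x ∈ D e <;> simp [char, hx]
  have key := ofReal_mul_integral_le_totalVariation hc hcut
    (s := fun e x => (min a b / a + min a b / b) * char D e x + -(min a b / b))
    (fun e => ((hD.memBV e).1.aestronglyMeasurable.const_mul _).add aestronglyMeasurable_const)
    (fun e x => by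
      rw [hval]
      split_ifs
      · rw [abs_of_pos (div_pos hm0 ha0)]
        exact (div_le_one ha0).2 (min_le_left _ _)
      · rw [abs_neg, abs_of_pos (div_pos hm0 hb0)]
        exact (div_le_one hb0).2 (min_le_right _ _))
    (by
      rw [hD.integral_mul_char_add, ← ha, ← hab]
      field_simp
      ring) (char D)
  have hint : (Γ.integral fun e x => char D e x *
      ((min a b / a + min a b / b) * char D e x + -(min a b / b))) = min a b := by
    have heq : (fun e x => char D e x *
        ((min a b / a + min a b / b) * char D e x + -(min a b / b))) =
        fun e x => min a b / a * char D e x + 0 := by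
      ext e x
      rw [hval]
      by_cases hx : x ∈ D e <;> simp [char, hx]
    rw [heq, hD.integral_mul_char_add, ← ha, zero_mul, add_zero, div_mul_cancel₀ _ ha0.ne']
  rw [hint, ENNReal.ofReal_mul hc, ← hmin] at key
  refine (ENNReal.le_div_iff_mul_le (Or.inl ?_) (Or.inl ?_)).2 key
  · exact (lt_min h0 hpos').ne'
  · rw [hmin]
    exact ENNReal.ofReal_ne_top

/-! ### Existence of an optimal set -/

theorem totalVariation_const_mul_le {c : ℝ} (hc : 0 ≤ c) (u : E → ℝ → ℝ) :
    Γ.totalVariation (fun e x => c * u e x) ≤ ENNReal.ofReal c * Γ.totalVariation u := by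
  refine iSup_le fun z => iSup_le fun w => iSup_le fun h => iSup_le fun hz => ?_
  have heq : (Γ.integral fun e x => c * u e x * w e x) =
      c * Γ.integral fun e x => u e x * w e x := by
    unfold integral
    rw [Finset.mul_sum]
    refine Finset.sum_congr rfl fun e _ => ?_
    rw [← integral_const_mul]
    simp only [mul_assoc]
  rw [heq, abs_mul, abs_of_nonneg hc, ENNReal.ofReal_mul hc]
  gcongr
  exact le_iSup_of_le z (le_iSup_of_le w (le_iSup_of_le h (le_iSup_of_le hz le_rfl)))

/-- An elementary cut or its complement fills at most half of the graph. -/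
theorem exists_isFinitePerimeter_of_mem_elementaryCuts [Fintype V] {i : Finset V ⊕ E}
    {p : (E → ℝ) × (E → ℝ)} (hp : p ∈ Γ.elementaryCuts i) :
    ∃ D, Γ.IsFinitePerimeter D ∧ length D = ENNReal.ofReal (Γ.cutMass p) ∧
      Γ.perimeter D ≤ ENNReal.ofReal (Γ.boundaryCount i) := by
  have hbox := Γ.elementaryCuts_subset i hp
  have hfp := Γ.isFinitePerimeter_segments hbox
  have hper := Γ.perimeter_segments_le hp
  have hlen := length_segments hbox
  have h0 : 0 ≤ segmentsLength p := Finset.sum_nonneg fun e _ => by linarith [hbox e]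
  rcases le_total (segmentsLength p) (∑ e, Γ.len e - segmentsLength p) with h | h
  · exact ⟨segments p, hfp, by rw [hlen, cutMass, min_eq_left h], hper⟩
  · refine ⟨Γ.compl (segments p), hfp.compl, ?_, hfp.perimeter_compl_le.trans hper⟩
    have hadd := hfp.length_add_length_compl
    rw [cutMass, min_eq_right h, ENNReal.ofReal_sub _ h0, ← totalLength_eq_ofReal, ← hlen, ← hadd,
      ENNReal.add_sub_cancel_left]
    rw [hlen]
    exact ENNReal.ofReal_ne_top

end CompactMetricGraph

/-! ### The main theorem -/

open CompactMetricGraph in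
theorem theorem4p1 {V E : Type*} [Fintype V] [Fintype E] [Nonempty E]
    (Γ : CompactMetricGraph V E) :
    Γ.cheegerConstant = Γ.lambdaOne ∧ Γ.lambdaOne ≠ ⊤ ∧
      ∃ u : E → ℝ → ℝ, Γ.Admissible u ∧ Γ.totalVariation u = Γ.lambdaOne ∧
        ∃ t : ℝ, 0 ≤ t ∧ Γ.IsCheegerCut (Γ.superlevel u t) := by
  obtain ⟨i, p, hp, hm, hcut⟩ := Γ.exists_optimal_elementaryCut
  obtain ⟨D, hD, hlen, hper⟩ := exists_isFinitePerimeter_of_mem_elementaryCuts hp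
  set m := Γ.cutMass p with hmdef
  set c := Γ.boundaryCount i / m with hcdef
  have hc : 0 ≤ c := div_nonneg (Γ.boundaryCount_nonneg i) hm.le
  have hpos : 0 < length D := by rw [hlen]; exact ENNReal.ofReal_pos.2 hm
  have hhalf : length D ≤ Γ.totalLength / 2 := by
    rw [hlen, totalLength_eq_ofReal, show (2 : ℝ≥0∞) = ENNReal.ofReal 2 by simp,
      ← ENNReal.ofReal_div_of_pos two_pos]
    refine ENNReal.ofReal_le_ofReal ?_
    have h1 := min_le_left (segmentsLength p) (∑ e, Γ.len e - segmentsLength p)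
    have h2 := min_le_right (segmentsLength p) (∑ e, Γ.len e - segmentsLength p)
    rw [hmdef, cutMass]
    linarith
  have hT : Γ.totalLength ≠ ⊤ := by rw [totalLength_eq_ofReal]; exact ENNReal.ofReal_ne_top
  have hfin : length D ≠ ⊤ := by rw [hlen]; exact ENNReal.ofReal_ne_top
  have hT0 : Γ.totalLength ≠ 0 := fun h => by simp [h] at hhalf; exact hpos.ne' hhalf
  have hlt : length D < Γ.totalLength := hhalf.trans_lt (ENNReal.half_lt_self hT0 hT)
  have hle_compl : length D ≤ length (Γ.compl D) := by
    by_contra! h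
    have hsum : length D + length (Γ.compl D) < Γ.totalLength / 2 + Γ.totalLength / 2 :=
      ENNReal.add_lt_add_of_le_of_lt hfin hhalf (h.trans_le hhalf)
    rw [hD.length_add_length_compl, ENNReal.add_halves] at hsum
    exact lt_irrefl _ hsum
  have hratio : Γ.perimeter D / length D ≤ ENNReal.ofReal c := by
    rw [hcdef, ENNReal.ofReal_div_of_pos hm, hlen]
    exact ENNReal.div_le_div_right hper _
  have hcheeger_ge : ENNReal.ofReal c ≤ Γ.cheegerConstant :=
    le_iInf fun D' => le_iInf fun h => le_iInf fun h0 => le_iInf fun h1 =>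
      h.ofReal_le_perimeter_div hc hcut h0 h1
  have hlambda_ge : ENNReal.ofReal c ≤ Γ.lambdaOne :=
    le_iInf fun u => le_iInf fun hu => hu.ofReal_le_totalVariation hc hcut
  have hcheeger_le : Γ.cheegerConstant ≤ Γ.perimeter D / length D := by
    refine iInf_le_of_le D (iInf_le_of_le hD (iInf_le_of_le hpos (iInf_le_of_le hlt ?_)))
    rw [min_eq_left hle_compl]
  -- Since `D` has length `m`, this function has norm `1`; as `D` fills at most half of the graph,
  -- `0` is a median. The level `t = 0` recovers `D`.
  set u : E → ℝ → ℝ := fun e x => m⁻¹ * char D e x with hu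
  have hsup : Γ.superlevel u 0 = D := by
    ext e x
    by_cases hx : x ∈ D e
    · have := hD.subset e hx
      simp only [superlevel, mem_ofPred_eq, hu, char, indicator_of_mem hx, hx, iff_true]
      exact ⟨this, by positivity⟩
    · simp [superlevel, hu, char, hx]
  have hsub : Γ.sublevel u 0 = fun _ => ∅ := by
    ext e x
    by_cases hx : x ∈ D e <;> simp [sublevel, hu, char, hx, hm.le]
  have hadm : Γ.Admissible u := by
    refine ⟨fun e => (hD.memBV e).const_mul (inv_nonneg.2 hm.le), ?_, ?_, ?_⟩
    · have heq : (fun e x => |u e x|) = fun e x => m⁻¹ * char D e x + 0 := by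
        ext e x
        by_cases hx : x ∈ D e <;> simp [hu, char, hx, hm.le]
      rw [heq, hD.integral_mul_char_add, hlen, ENNReal.toReal_ofReal hm.le, zero_mul, add_zero,
        inv_mul_cancel₀ hm.ne']
    · rw [hsub]
      simp [length]
    · rw [hsup]
      exact hhalf
  have hTV : Γ.totalVariation u ≤ ENNReal.ofReal c := by
    refine (totalVariation_const_mul_le (inv_nonneg.2 hm.le) _).trans (le_trans ?_ hratio)
    rw [ENNReal.ofReal_inv_of_pos hm, ← hlen, mul_comm, ← div_eq_mul_inv]
    rfl
  have hlambda_le : Γ.lambdaOne ≤ Γ.totalVariation u := iInf₂_le u hadm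
  have hlambda : Γ.lambdaOne = ENNReal.ofReal c := le_antisymm (hlambda_le.trans hTV) hlambda_ge
  have hcheeger : Γ.cheegerConstant = ENNReal.ofReal c :=
    le_antisymm (hcheeger_le.trans hratio) hcheeger_ge
  refine ⟨hcheeger.trans hlambda.symm, by rw [hlambda]; exact ENNReal.ofReal_ne_top, u, hadm,
    le_antisymm (hTV.trans hlambda.ge) hlambda_le, 0, le_rfl, ?_⟩
  rw [hsup]
  exact ⟨hD, hpos, hhalf, le_antisymm hcheeger_le (hratio.trans hcheeger.ge)⟩
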